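/- Let $K$ be a field, $S=K[x_1,\dots,x_n]$ with the standard grading, and let $\Delta$ be a simplicial complex on the vertex set $\{1,\dots,n\}$ (every $\{i\}$ is a face) of dimension $1$. Fix a monomial order on $S$ for which $x_1>x_i$ for all $i>1$. Let $I_\Delta\subset S$ be the Stanley–Reisner ideal of $\Delta$, generated by the monomials $\mathbf{x}_F=\prod_{i\in F}x_i$ with $F\subset\{1,\dots,n\}$, $F\notin\Delta$. Let $I\subset S$ be a homogeneous ideal whose initial ideal is $\operatorname{in}(I)=I_\Delta$, and let $\{f_F \mid F \text{ a minimal non-face of } \Delta\}$ be the reduced Gröbner basis of $I$, consisting of homogeneous polynomials, with $\operatorname{in}(f_F)=\mathbf{x}_F$. Call a vertex of $\Delta$ a leaf if it is contained in exactly one maximal face of $\Delta$. If the vertex $1$ is not a leaf, then $P_1=[1:0:\dots:0]$ is a point of $\operatorname{Proj} S/I$, and it is a singular point, i.e. the local ring of $\operatorname{Proj} S/I$ at $P_1$ is not regular. -/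

import Mathlib

open MvPolynomial AlgebraicGeometry
open scoped DirectSum MonomialOrder

attribute [local instance] MvPolynomial.gradedAlgebra

/-! ### Simplicial complexes and Stanley–Reisner ideals

Simplicial complexes on the vertex set `Fin n` are Mathlib's `AbstractSimplicialComplex (Fin n)`:
faces are nonempty finite sets (the empty face is left implicit), and every singleton is a face. -/

/-- `Δ` has dimension `d`: the largest faces have exactly `d + 1` elements. -/
def AbstractSimplicialComplex.HasDim {ι : Type*} (Δ : AbstractSimplicialComplex ι) (d : ℕ) : Prop :=
  (∃ F ∈ Δ.faces, F.card = d + 1) ∧ ∀ F ∈ Δ.faces, F.card ≤ d + 1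

/-- A maximal face (facet) of `Δ`. -/
def AbstractSimplicialComplex.IsMaximalFace {ι : Type*} (Δ : AbstractSimplicialComplex ι)
    (F : Finset ι) : Prop :=
  Maximal (fun G => G ∈ Δ.faces) F

/-- A leaf of `Δ` is a vertex which is contained in exactly one maximal face. -/
def AbstractSimplicialComplex.IsLeaf {ι : Type*} (Δ : AbstractSimplicialComplex ι) (v : ι) : Prop :=
  ∃! F : Finset ι, Δ.IsMaximalFace F ∧ v ∈ F

/-- A non-face of `Δ`; the empty set always counts as a face. -/
def AbstractSimplicialComplex.IsNonface {ι : Type*} (Δ : AbstractSimplicialComplex ι)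
    (F : Finset ι) : Prop :=
  F.Nonempty ∧ F ∉ Δ.faces

/-- A minimal non-face of `Δ`. -/
def AbstractSimplicialComplex.IsMinimalNonface {ι : Type*} (Δ : AbstractSimplicialComplex ι)
    (F : Finset ι) : Prop :=
  Minimal Δ.IsNonface F

/-- The Stanley–Reisner ideal `I_Δ`, generated by the monomials `x_F`, `F` a non-face of `Δ`. -/
noncomputable def stanleyReisnerIdeal {ι : Type*} (K : Type*) [Field K]
    (Δ : AbstractSimplicialComplex ι) : Ideal (MvPolynomial ι K) :=
  Ideal.span {p | ∃ F : Finset ι, Δ.IsNonface F ∧ p = ∏ i ∈ F, X i}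

/-! ### Initial ideals and reduced Gröbner bases -/

/-- The initial ideal of `I`, generated by the leading terms of the elements of `I`. -/
noncomputable def initialIdeal {ι K : Type*} [Field K] (m : MonomialOrder ι)
    (I : Ideal (MvPolynomial ι K)) : Ideal (MvPolynomial ι K) :=
  Ideal.span (m.leadingTerm '' (I : Set (MvPolynomial ι K)))

/-- `G` is the reduced Gröbner basis of `I`: a set of monic elements of `I`, whose leading terms
generate the initial ideal of `I`, and such that no monomial in the support of an element of `G` is
divisible by the leading monomial of another element of `G`. -/
structure IsReducedGroebnerBasis {ι K : Type*} [Field K] (m : MonomialOrder ι)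
    (I : Ideal (MvPolynomial ι K)) (G : Set (MvPolynomial ι K)) : Prop where
  subset : G ⊆ I
  span_leadingTerm : Ideal.span (m.leadingTerm '' G) = initialIdeal m I
  monic : ∀ g ∈ G, m.Monic g
  reduced : ∀ g ∈ G, ∀ c ∈ g.support, ∀ h ∈ G, h ≠ g → ¬ m.degree h ≤ c

/-! ### The standard graded ring `S/I` and its `Proj` -/

/-- The grading of `S/I` by the images of the spaces of forms of degree `d`. -/
noncomputable def quotientGrading {ι K : Type*} [Field K] (I : Ideal (MvPolynomial ι K)) :
    ℕ → Submodule K (MvPolynomial ι K ⧸ I) :=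
  fun d => (homogeneousSubmodule ι K d).map (Ideal.Quotient.mkₐ K I).toLinearMap

theorem mk_mem_quotientGrading {ι K : Type*} [Field K] (I : Ideal (MvPolynomial ι K)) {d : ℕ}
    {p : MvPolynomial ι K} (hp : p ∈ homogeneousSubmodule ι K d) :
    Ideal.Quotient.mk I p ∈ quotientGrading I d :=
  ⟨p, hp, rfl⟩

theorem quotientGrading_gradedMonoid {ι K : Type*} [Field K] (I : Ideal (MvPolynomial ι K)) :
    SetLike.GradedMonoid (quotientGrading I) where
  one_mem := ⟨1, SetLike.GradedOne.one_mem, map_one (Ideal.Quotient.mk I)⟩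
  mul_mem := by
    rintro i j _ _ ⟨p, hp, rfl⟩ ⟨q, hq, rfl⟩
    exact ⟨p * q, SetLike.GradedMul.mul_mem hp hq, map_mul (Ideal.Quotient.mk I) p q⟩

/-- The map `S → ⨁ (S/I)_d` sending a polynomial to the classes of its homogeneous components. -/
noncomputable def quotientComponents {ι K : Type*} [Field K] (I : Ideal (MvPolynomial ι K)) :
    MvPolynomial ι K →+ ⨁ d, quotientGrading I d :=
  (DirectSum.map (fun d => (AddMonoidHom.mk'
      (fun p : homogeneousSubmodule ι K d =>
        (⟨Ideal.Quotient.mk I (p : MvPolynomial ι K), mk_mem_quotientGrading I p.2⟩ :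
          quotientGrading I d))
      (fun _ _ => Subtype.ext (map_add _ _ _))))).comp
    (DirectSum.decomposeAddEquiv (homogeneousSubmodule ι K)).toAddMonoidHom

theorem quotientComponents_apply {ι K : Type*} [Field K] (I : Ideal (MvPolynomial ι K))
    (p : MvPolynomial ι K) (d : ℕ) :
    (quotientComponents I p d : MvPolynomial ι K ⧸ I) =
      Ideal.Quotient.mk I (DirectSum.decompose (homogeneousSubmodule ι K) p d) := rfl

theorem quotientComponents_eq_zero {ι K : Type*} [Field K] (I : Ideal (MvPolynomial ι K))
    (hI : I.IsHomogeneous (homogeneousSubmodule ι K)) (p : MvPolynomial ι K) (hp : p ∈ I) :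
    quotientComponents I p = 0 := by
  refine DFinsupp.ext fun d => Subtype.ext ?_
  rw [quotientComponents_apply]
  exact Ideal.Quotient.eq_zero_iff_mem.mpr (hI d hp)

/-- The map `S/I → ⨁ (S/I)_d` induced by `quotientComponents`, for a homogeneous ideal `I`. -/
noncomputable def quotientDecompose {ι K : Type*} [Field K] (I : Ideal (MvPolynomial ι K))
    (hI : I.IsHomogeneous (homogeneousSubmodule ι K)) :
    (MvPolynomial ι K ⧸ I) →+ ⨁ d, quotientGrading I d :=
  QuotientAddGroup.lift I.toAddSubgroup (quotientComponents I) (quotientComponents_eq_zero I hI)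

/-- If `I` is homogeneous, then `S/I` is a graded `K`-algebra. -/
@[reducible]
noncomputable def quotientGradedAlgebra {ι K : Type*} [Field K] (I : Ideal (MvPolynomial ι K))
    (hI : I.IsHomogeneous (homogeneousSubmodule ι K)) : GradedAlgebra (quotientGrading I) where
  toGradedMonoid := quotientGrading_gradedMonoid I
  decompose' := quotientDecompose I hI
  left_inv := by
    intro x
    obtain ⟨p, rfl⟩ := Ideal.Quotient.mk_surjective x
    change DirectSum.coeAddMonoidHom (quotientGrading I) (quotientComponents I p) = _
    induction p using DirectSum.Decomposition.inductionOn (homogeneousSubmodule ι K) with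
    | zero => simp
    | add p q hp hq => simp only [map_add, hp, hq]
    | @homogeneous d p =>
      have h : quotientComponents I (p : MvPolynomial ι K) =
          DirectSum.of (fun d => quotientGrading I d) d
            ⟨Ideal.Quotient.mk I p, mk_mem_quotientGrading I p.2⟩ := by
        simp [quotientComponents, DirectSum.decompose_coe]
      rw [h, DirectSum.coeAddMonoidHom_of]
  right_inv := by
    intro x
    induction x using DirectSum.induction_on with
    | zero => simp
    | add x y hx hy => simp only [map_add, hx, hy]
    | of d x =>
      obtain ⟨_, p, hp, rfl⟩ := x
      rw [DirectSum.coeAddMonoidHom_of]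
      change quotientComponents I p = _
      lift p to homogeneousSubmodule ι K d using hp
      simp [quotientComponents, DirectSum.decompose_coe]

/-- The projective scheme `Proj S/I` of a homogeneous ideal `I`. -/
noncomputable def projQuotient {ι K : Type*} [Field K] (I : Ideal (MvPolynomial ι K))
    (hI : I.IsHomogeneous (homogeneousSubmodule ι K)) : Scheme :=
  letI := quotientGradedAlgebra I hI
  Proj (quotientGrading I)

/-- The homogeneous prime ideal of `S` that contains `I` and corresponds to a point of `Proj S/I`. -/
noncomputable def pointIdeal {ι K : Type*} [Field K] {I : Ideal (MvPolynomial ι K)}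
    {hI : I.IsHomogeneous (homogeneousSubmodule ι K)} (P : projQuotient I hI) :
    Ideal (MvPolynomial ι K) :=
  letI := quotientGradedAlgebra I hI
  (ProjectiveSpectrum.asHomogeneousIdeal (𝒜 := quotientGrading I) P).toIdeal.comap
    (Ideal.Quotient.mk I)

/-- `P` is the point of `Proj S/I` all of whose homogeneous coordinates other than the one at `v`
vanish, i.e. its homogeneous prime ideal in `S` is generated by the variables `x_j`, `j ≠ v`. -/
def IsCoordinatePoint {ι K : Type*} [Field K] {I : Ideal (MvPolynomial ι K)}
    {hI : I.IsHomogeneous (homogeneousSubmodule ι K)} (v : ι) (P : projQuotient I hI) : Prop :=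
  pointIdeal P = Ideal.span ((fun j => (X j : MvPolynomial ι K)) '' {j | j ≠ v})

/-- A point of a scheme is singular if its local ring is not a regular local ring. -/
def IsSingularPoint (Y : Scheme) (P : Y) : Prop :=
  ¬ IsRegularLocalRing (Y.presheaf.stalk P)

/-! Write `v` for the vertex 1. The local ring `R` at the coordinate point is the degree-zero part
of the localization of `S/I`, in which `x_v` becomes 1. Standard monomials involve at most two
variables, so the Hilbert function of `S/I` grows at most linearly and `dim R ≤ 1`
(`ringKrullDim_le_one_of_dehomogenization`). If `R` were regular, its maximal ideal would be
principal, and any two nonzero nonunits would have associated positive powers.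

A non-leaf `v` lies on two edges `{v, a}` and `{v, b}`, and `x_a`, `x_b` are nonzero nonunits of
`R`. A relation `x_a^k = u x_b^l` with `u` a unit lifts to a form `c (q x_v^l x_a^k - p x_v^k
x_b^l)` in `I` with `c`, `p`, `q` nonzero at the point. As `x_v` is the largest variable, `c`, `p`,
`q` have powers of `x_v` as leading monomials. The two products thus have distinct leading
monomials, supported on `{v, a}` and `{v, b}`. One of them leads the difference, yet `in(I) = I_Δ`
contains no monomial supported on a face. -/

/-! ### Krull dimension bounds and regular local rings of dimension at most one -/

theorem ringKrullDim_le_of_ringHom_isIntegral {A B : Type*} [CommRing A] [CommRing B] (f : A →+* B)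
    (hf : f.IsIntegral) : ringKrullDim B ≤ ringKrullDim A := by
  algebraize [f]
  refine Order.krullDim_le_of_strictMono (PrimeSpectrum.comap (algebraMap A B)) fun p q hpq => ?_
  exact Ideal.IsIntegral.comap_lt_comap (show p.asIdeal < q.asIdeal from hpq)

/-- Up to units every element of `R` comes from `B`, so a prime of `R` is determined by its
contraction, as for a localization. -/
theorem ringKrullDim_le_of_forall_exists_isUnit_mul {B R : Type*} [CommRing B] [CommRing R]
    (f : B →+* R) (hf : ∀ r : R, ∃ b : B, ∃ u : R, IsUnit u ∧ u * r = f b) :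
    ringKrullDim R ≤ ringKrullDim B := by
  refine Order.krullDim_le_of_strictMono (PrimeSpectrum.comap f) fun p q hpq => ?_
  refine lt_of_le_of_ne (Ideal.comap_mono hpq.le) fun h => hpq.not_ge fun r hr => ?_
  obtain ⟨b, u, hu, hb⟩ := hf r
  have h1 : f b ∈ q.asIdeal := hb ▸ q.asIdeal.mul_mem_left u hr
  have h2 : b ∈ (PrimeSpectrum.comap f p).asIdeal := by rw [h]; exact h1
  have h3 : u * r ∈ p.asIdeal := hb ▸ h2
  exact (Ideal.unit_mul_mem_iff_mem _ hu).1 h3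

/-- By Noether normalization, dimension at least two would give two algebraically independent
elements, whose monomials grow quadratically in number; the hypothesis allows only linear growth. -/
theorem ringKrullDim_le_one_of_card_span_le {K B σ : Type*} [Field K] [CommRing B] [Nontrivial B]
    [Algebra K B] [Algebra.FiniteType K B] (φ : MvPolynomial σ K →ₐ[K] B)
    (hφ : Function.Surjective φ) (C : ℕ)
    (hC : ∀ d : ℕ, ∃ s : Finset B, s.card ≤ C * (d + 1) ∧
      ∀ p : MvPolynomial σ K, p.totalDegree ≤ d → φ p ∈ Submodule.span K (s : Set B)) :
    ringKrullDim B ≤ 1 := by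
  obtain ⟨s, g, hg, hint⟩ := exists_integral_inj_algHom_of_fg K B
  refine (ringKrullDim_le_of_ringHom_isIntegral g.toRingHom hint).trans ?_
  rw [MvPolynomial.ringKrullDim_of_isNoetherianRing, ringKrullDim_eq_zero_of_field, zero_add,
    Nat.card_eq_fintype_card, Fintype.card_fin]
  by_contra! hs
  have hs : 1 < s := by exact_mod_cast hs
  let i : Fin s := ⟨0, by omega⟩
  let j : Fin s := ⟨1, hs⟩
  have hij : i ≠ j := by simp [i, j]
  obtain ⟨p, hp⟩ := hφ (g (X i))
  obtain ⟨q, hq⟩ := hφ (g (X j))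
  set e := p.totalDegree + q.totalDegree with he
  -- Chosen so that `C * (k * e + 1) ≤ k * (k + 1) < (k + 1) ^ 2`: the span is too small for the
  -- monomials with both exponents at most `k`, of degree at most `k * e`.
  set k := C * (e + 1) with hk
  obtain ⟨t, ht, hspan⟩ := hC (k * e)
  let v : Fin (k + 1) × Fin (k + 1) → B := fun x => φ (p ^ (x.1 : ℕ) * q ^ (x.2 : ℕ))
  have hv : LinearIndependent K v := by
    have h1 : LinearIndependent K (fun x : Fin (k + 1) × Fin (k + 1) =>
        (monomial (Finsupp.single i (x.1 : ℕ) + Finsupp.single j (x.2 : ℕ)) (1 : K))) := by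
      have := (basisMonomials (Fin s) K).linearIndependent.comp
        (fun x : Fin (k + 1) × Fin (k + 1) =>
          Finsupp.single i (x.1 : ℕ) + Finsupp.single j (x.2 : ℕ)) ?_
      · simpa [Function.comp_def] using this
      · intro x y hxy
        have h1 := DFunLike.congr_fun hxy i
        have h2 := DFunLike.congr_fun hxy j
        simp [hij, hij.symm] at h1 h2
        exact Prod.ext (Fin.ext h1) (Fin.ext h2)
    have h2 := h1.map' g.toLinearMap (LinearMap.ker_eq_bot.2 hg)
    have hvg : v = g.toLinearMap ∘ fun x : Fin (k + 1) × Fin (k + 1) =>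
        monomial (Finsupp.single i (x.1 : ℕ) + Finsupp.single j (x.2 : ℕ)) (1 : K) := ?_
    · rw [hvg]; exact h2
    funext x
    simp only [v, map_mul, map_pow, hp, hq, Function.comp_apply, AlgHom.toLinearMap_apply]
    rw [← map_pow, ← map_pow, ← map_mul, X_pow_eq_monomial, X_pow_eq_monomial, monomial_mul, one_mul]
  have hmem : ∀ x, v x ∈ Submodule.span K (t : Set B) := by
    intro x
    refine hspan _ ((totalDegree_mul _ _).trans ?_)
    refine (add_le_add (totalDegree_pow _ _) (totalDegree_pow _ _)).trans ?_
    have h1 : (x.1 : ℕ) ≤ k := by omega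
    have h2 : (x.2 : ℕ) ≤ k := by omega
    rw [he, mul_add]
    gcongr
  have hle : (k + 1) * (k + 1) ≤ t.card := by
    have h1 : LinearIndependent K
        (fun x => (⟨v x, hmem x⟩ : Submodule.span K (t : Set B))) :=
      LinearIndependent.of_comp (Submodule.subtype _) hv
    have h2 := h1.fintype_card_le_finrank
    simp only [Fintype.card_prod, Fintype.card_fin] at h2
    exact h2.trans (finrank_span_finset_le_card t)
  have : C * (k * e + 1) ≤ k * (k + 1) := by
    rw [hk]; nlinarith [Nat.zero_le (C * e), Nat.zero_le (C * (e + 1) * e * C), Nat.zero_le C]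
  nlinarith

theorem isPrincipal_maximalIdeal_of_ringKrullDim_le_one {R : Type*} [CommRing R]
    [IsRegularLocalRing R] (h : ringKrullDim R ≤ 1) : (IsLocalRing.maximalIdeal R).IsPrincipal := by
  rw [← IsLocalRing.finrank_cotangentSpace_le_one_iff]
  have := (IsRegularLocalRing.iff_finrank_cotangentSpace R).1 ‹IsRegularLocalRing R›
  rw [← this] at h
  exact_mod_cast h

/-- Otherwise a further factor `t` could always be extracted, placing `x` in every power of the
maximal ideal, against Krull's intersection theorem. -/
theorem exists_isUnit_mul_pow_of_maximalIdeal_eq_span {R : Type*} [CommRing R] [IsLocalRing R]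
    [IsNoetherianRing R] {t : R} (ht : IsLocalRing.maximalIdeal R = Ideal.span {t}) {x : R}
    (hx : x ≠ 0) : ∃ k : ℕ, ∃ u : R, IsUnit u ∧ x = u * t ^ k := by
  by_contra! h
  refine hx ?_
  rw [← Submodule.mem_bot R, ← Ideal.iInf_pow_eq_bot_of_isLocalRing (IsLocalRing.maximalIdeal R)
    Ideal.IsPrime.ne_top', Ideal.mem_iInf]
  intro k
  simp only [ht, Ideal.span_singleton_pow, Ideal.mem_span_singleton']
  induction k with
  | zero => exact ⟨x, by simp⟩
  | succ k ih =>
    obtain ⟨u, hu⟩ := ih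
    have hu' : u ∈ IsLocalRing.maximalIdeal R := by
      rw [IsLocalRing.mem_maximalIdeal]
      exact fun hunit => h k u hunit hu.symm
    rw [ht, Ideal.mem_span_singleton'] at hu'
    obtain ⟨w, rfl⟩ := hu'
    exact ⟨w, by rw [← hu]; ring⟩

/-- In a regular local ring of dimension at most one, any two nonzero nonunits have positive powers
that are associated. -/
theorem IsRegularLocalRing.exists_isUnit_mul_pow_eq_pow {R : Type*} [CommRing R]
    [IsRegularLocalRing R] (h : ringKrullDim R ≤ 1) {x y : R} (hx : x ≠ 0) (hy : y ≠ 0)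
    (hx' : ¬ IsUnit x) (hy' : ¬ IsUnit y) :
    ∃ k l : ℕ, k ≠ 0 ∧ l ≠ 0 ∧ ∃ u : R, IsUnit u ∧ x ^ k = u * y ^ l := by
  obtain ⟨t, ht⟩ := (isPrincipal_maximalIdeal_of_ringKrullDim_le_one h).principal
  obtain ⟨a, u, hu, hxu⟩ := exists_isUnit_mul_pow_of_maximalIdeal_eq_span ht hx
  obtain ⟨b, w, hw, hyw⟩ := exists_isUnit_mul_pow_of_maximalIdeal_eq_span ht hy
  -- Both `x ^ b` and `y ^ a` are units times `t ^ (a * b)`; `a` and `b` are nonzero because `x` and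
  -- `y` are nonunits.
  refine ⟨b, a, ?_, ?_, ?_⟩
  · rintro rfl; exact hy' (by simpa [hyw] using hw)
  · rintro rfl; exact hx' (by simpa [hxu] using hu)
  · obtain ⟨w', hw'⟩ := (hw.pow a).exists_left_inv
    refine ⟨u ^ b * w', (hu.pow b).mul (IsUnit.of_mul_eq_one _ hw'), ?_⟩
    rw [hxu, hyw, mul_pow, mul_pow, ← pow_mul, ← pow_mul, mul_comm b a]
    linear_combination (-(u ^ b * t ^ (a * b))) * hw'

/-! ### Initial ideals equal to a Stanley–Reisner ideal -/

/-- The ideal is monomial, `x_F` divides `x^s` exactly when `F ⊆ s.support`, and nonfaces are closed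
under enlargement. -/
theorem mem_stanleyReisnerIdeal_iff {ι K : Type*} [Field K] (Δ : AbstractSimplicialComplex ι)
    (p : MvPolynomial ι K) :
    p ∈ stanleyReisnerIdeal K Δ ↔ ∀ s ∈ p.support, Δ.IsNonface s.support := by
  classical
  have h : stanleyReisnerIdeal K Δ = Ideal.span ((fun s => monomial s (1 : K)) ''
      {s | ∃ F : Finset ι, Δ.IsNonface F ∧ s = ∑ i ∈ F, Finsupp.single i 1}) := by
    unfold stanleyReisnerIdeal
    congr 1
    ext q
    simp only [Set.mem_ofPred_eq, Set.mem_image]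
    constructor
    · rintro ⟨F, hF, rfl⟩
      exact ⟨_, ⟨F, hF, rfl⟩, by simp [monomial_sum_one, X]⟩
    · rintro ⟨_, ⟨F, hF, rfl⟩, rfl⟩
      exact ⟨F, hF, by simp [monomial_sum_one, X]⟩
  rw [h, mem_ideal_span_monomial_image]
  refine forall₂_congr fun s _ => ?_
  have hle (F : Finset ι) : (∑ i ∈ F, Finsupp.single i 1) ≤ s ↔ F ⊆ s.support := by
    constructor
    · intro hs i hi
      have := hs i
      simp only [Finsupp.coe_finsetSum, Finset.sum_apply, Finsupp.single_apply] at this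
      simp [hi] at this
      simp; omega
    · intro hs i
      simp only [Finsupp.coe_finsetSum, Finset.sum_apply, Finsupp.single_apply]
      by_cases hi : i ∈ F
      · have := hs hi
        simp at this
        simp [hi]; omega
      · simp [hi]
  constructor
  · rintro ⟨_, ⟨F, hF, rfl⟩, hFs⟩
    rw [hle] at hFs
    exact ⟨hF.1.mono hFs, fun hs => hF.2 (Δ.isRelLowerSet_faces hs |>.2 hFs hF.1)⟩
  · intro hs
    exact ⟨_, ⟨_, hs, rfl⟩, (hle _).2 subset_rfl⟩

theorem isNonface_support_degree {ι K : Type*} [Field K] {m : MonomialOrder ι}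
    {I : Ideal (MvPolynomial ι K)} {Δ : AbstractSimplicialComplex ι}
    (hin : initialIdeal m I = stanleyReisnerIdeal K Δ) {p : MvPolynomial ι K} (hp : p ∈ I)
    (hp0 : p ≠ 0) : Δ.IsNonface (m.degree p).support := by
  have h : m.leadingTerm p ∈ initialIdeal m I := Ideal.subset_span ⟨p, hp, rfl⟩
  rw [hin, mem_stanleyReisnerIdeal_iff] at h
  exact h _ (by rw [m.support_leadingTerm' hp0]; simp)

theorem exists_mem_degree_eq {ι K : Type*} [Field K] {m : MonomialOrder ι}
    {I : Ideal (MvPolynomial ι K)} {Δ : AbstractSimplicialComplex ι}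
    (hin : initialIdeal m I = stanleyReisnerIdeal K Δ) {s : ι →₀ ℕ} (hs : Δ.IsNonface s.support) :
    ∃ p ∈ I, p ≠ 0 ∧ m.degree p = s := by
  classical
  have h : monomial s (1 : K) ∈ initialIdeal m I := by
    rw [hin, mem_stanleyReisnerIdeal_iff]
    intro t ht
    obtain rfl : t = s := by simpa using support_monomial_subset ht
    exact hs
  have h2 : initialIdeal m I ≤ Ideal.span ((fun s => monomial s (1 : K)) ''
      {s | ∃ p ∈ I, p ≠ 0 ∧ m.degree p = s}) := by
    refine Ideal.span_le.2 ?_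
    rintro _ ⟨p, hp, rfl⟩
    by_cases hp0 : p = 0
    · simp [hp0]
    · rw [SetLike.mem_coe, mem_ideal_span_monomial_image]
      intro t ht
      rw [m.support_leadingTerm' hp0, Finset.mem_singleton] at ht
      exact ⟨t, ⟨p, hp, hp0, ht.symm⟩, le_rfl⟩
  obtain ⟨_, ⟨p, hp, hp0, rfl⟩, hle⟩ := mem_ideal_span_monomial_image.1 (h2 h) s (by simp)
  have hmon : monomial (s - m.degree p) (1 : K) ≠ 0 := by simp
  refine ⟨monomial (s - m.degree p) 1 * p, I.mul_mem_left _ hp, mul_ne_zero hmon hp0, ?_⟩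
  rw [m.degree_mul hmon hp0, m.degree_monomial, if_neg one_ne_zero, tsub_add_cancel_of_le hle]

theorem homogeneousComponent_mem {ι K : Type*} [Field K] {I : Ideal (MvPolynomial ι K)}
    (hI : I.IsHomogeneous (homogeneousSubmodule ι K)) {p : MvPolynomial ι K} (hp : p ∈ I) (d : ℕ) :
    homogeneousComponent d p ∈ I := by
  have h := hI d hp
  rwa [show (DirectSum.decompose (homogeneousSubmodule ι K) p d : MvPolynomial ι K) =
    homogeneousComponent d p from decomposition.decompose'_apply p d] at h

theorem exists_isHomogeneous_mem_degree_eq {ι K : Type*} [Field K] {m : MonomialOrder ι}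
    {I : Ideal (MvPolynomial ι K)} {Δ : AbstractSimplicialComplex ι}
    (hI : I.IsHomogeneous (homogeneousSubmodule ι K))
    (hin : initialIdeal m I = stanleyReisnerIdeal K Δ) {s : ι →₀ ℕ} (hs : Δ.IsNonface s.support) :
    ∃ p ∈ I, p ≠ 0 ∧ p.IsHomogeneous s.degree ∧ m.degree p = s := by
  obtain ⟨p, hp, hp0, hdeg⟩ := exists_mem_degree_eq hin hs
  have hc : coeff s (homogeneousComponent s.degree p) ≠ 0 := by
    rw [coeff_homogeneousComponent, if_pos rfl, ← hdeg]
    exact m.leadingCoeff_ne_zero_iff.2 hp0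
  refine ⟨_, homogeneousComponent_mem hI hp s.degree, fun h => hc (by simp [h]),
    homogeneousComponent_isHomogeneous _ _, ?_⟩
  apply m.toSyn.injective
  refine le_antisymm (m.degree_le_iff.2 fun t ht => ?_) (m.le_degree (mem_support_iff.2 hc))
  rw [← hdeg]
  refine m.le_degree (mem_support_iff.2 fun h => mem_support_iff.1 ht ?_)
  rw [coeff_homogeneousComponent]
  simp [h]

/-- Every form is congruent modulo `I` to a combination of standard monomials of its degree. -/
theorem exists_sub_mem_span_standard {ι K : Type*} [Field K] {m : MonomialOrder ι}
    {I : Ideal (MvPolynomial ι K)} {Δ : AbstractSimplicialComplex ι}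
    (hI : I.IsHomogeneous (homogeneousSubmodule ι K))
    (hin : initialIdeal m I = stanleyReisnerIdeal K Δ) (d : ℕ) (p : MvPolynomial ι K)
    (hp : p.IsHomogeneous d) :
    ∃ q ∈ I, p - q ∈ Submodule.span K ((fun s => monomial s (1 : K)) ''
      {s | s.degree = d ∧ ¬ Δ.IsNonface s.support}) := by
  classical
  induction h : m.toSyn (m.degree p) using WellFoundedLT.induction generalizing p with
  | ind a ih =>
  by_cases hp0 : p = 0
  · exact ⟨0, I.zero_mem, by simp [hp0]⟩
  have hc := m.leadingCoeff_ne_zero_iff.2 hp0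
  have hdeg : (m.degree p).degree = d := by
    by_contra hne
    exact hc (hp.coeff_eq_zero hne)
  -- Cancelling the leading term strictly lowers the leading monomial, so induction applies to `p -
  -- g`. Below, `g` is a multiple of an element of `I` if that monomial is nonstandard, and the
  -- leading term itself otherwise.
  have key (g : MvPolynomial ι K) (hg : g.IsHomogeneous d) (hgd : m.degree g = m.degree p)
      (hg0 : m.leadingCoeff g = m.leadingCoeff p) :
      ∃ q ∈ I, p - g - q ∈ Submodule.span K ((fun s => monomial s (1 : K)) ''
        {s | s.degree = d ∧ ¬ Δ.IsNonface s.support}) := by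
    by_cases hpg : p - g = 0
    · exact ⟨0, I.zero_mem, by simp [hpg]⟩
    refine ih _ ?_ (p - g) (hp.sub hg) rfl
    rw [← h]
    refine lt_of_le_of_ne ?_ fun heq => ?_
    · simpa [hgd] using m.degree_sub_le (f := p) (g := g)
    · have h1 := m.leadingCoeff_ne_zero_iff.2 hpg
      rw [MonomialOrder.leadingCoeff, m.toSyn.injective heq, coeff_sub] at h1
      apply h1
      rw [MonomialOrder.leadingCoeff, MonomialOrder.leadingCoeff, hgd] at hg0
      rw [hg0, sub_self]
  by_cases hs : Δ.IsNonface (m.degree p).support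
  · obtain ⟨g, hgI, hg0, hgh, hgd⟩ := exists_isHomogeneous_mem_degree_eq hI hin hs
    have hgc := m.leadingCoeff_ne_zero_iff.2 hg0
    set c := m.leadingCoeff p / m.leadingCoeff g
    have hc0 : c ≠ 0 := div_ne_zero hc hgc
    have hcd : m.degree (c • g) = m.degree g :=
      m.degree_smul_of_mem_nonZeroDivisors (mem_nonZeroDivisors_of_ne_zero hc0)
    have hgh' : (c • g).IsHomogeneous d :=
      (homogeneousSubmodule ι K d).smul_mem c (hdeg ▸ hgh)
    have hcl : m.leadingCoeff (c • g) = m.leadingCoeff p := by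
      rw [MonomialOrder.leadingCoeff, hcd, coeff_smul, smul_eq_mul]
      exact div_mul_cancel₀ _ hgc
    obtain ⟨q, hq, hspan⟩ := key (c • g) hgh' (hcd.trans hgd) hcl
    refine ⟨c • g + q, I.add_mem (Submodule.smul_of_tower_mem I c hgI) hq, ?_⟩
    rwa [← sub_sub]
  · obtain ⟨q, hq, hspan⟩ := key (m.leadingTerm p) (isHomogeneous_monomial _ hdeg)
      (m.degree_leadingTerm p) (m.leadingCoeff_leadingTerm p)
    refine ⟨q, hq, ?_⟩
    have : p - q = (p - m.leadingTerm p - q) + m.leadingTerm p := by ring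
    rw [this]
    refine add_mem hspan ?_
    rw [MonomialOrder.leadingTerm, ← mul_one (m.leadingCoeff p), ← smul_eq_mul, ← smul_monomial]
    exact Submodule.smul_mem _ _ (Submodule.subset_span ⟨_, ⟨hdeg, hs⟩, rfl⟩)

/-- Source of the linear growth: a standard monomial of degree `d` is given by two indices and one
exponent at most `d`. `Inhabited` supplies the indices when `s = 0`. -/
theorem AbstractSimplicialComplex.HasDim.exists_eq_single_add_single {ι : Type*} [Inhabited ι]
    {Δ : AbstractSimplicialComplex ι} (hΔ : Δ.HasDim 1) {s : ι →₀ ℕ}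
    (hs : ¬ Δ.IsNonface s.support) :
    ∃ i j : ι, ∃ k ≤ s.degree, s = Finsupp.single i k + Finsupp.single j (s.degree - k) := by
  classical
  have hcard : s.support.card ≤ 2 := by
    by_cases h : s.support.Nonempty
    · exact hΔ.2 _ (by_contra fun h' => hs ⟨h, h'⟩)
    · rw [Finset.not_nonempty_iff_eq_empty.1 h]; simp
  interval_cases hc : s.support.card
  · have : s = 0 := by simpa using hc
    subst this
    exact ⟨default, default, 0, by simp⟩
  · obtain ⟨i, b, hb, rfl⟩ := Finsupp.card_support_eq_one'.1 hc
    exact ⟨i, i, b, by simp⟩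
  · obtain ⟨i, j, hij, hsupp⟩ := Finset.card_eq_two.1 hc
    have hs2 : s = Finsupp.single i (s i) + Finsupp.single j (s j) := by
      ext l
      have : l ∉ s.support ↔ l ≠ i ∧ l ≠ j := by simp [hsupp]
      by_cases hi : l = i
      · subst hi; simp [hij]
      · by_cases hj : l = j
        · subst hj; simp [hi]
        · have := this.2 ⟨hi, hj⟩
          simp at this
          simp [this, hi, hj]
    have hd : s.degree = s i + s j := by
      conv_lhs => rw [hs2]
      simp
    refine ⟨i, j, s i, by omega, ?_⟩
    rw [hd, Nat.add_sub_cancel_left]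
    exact hs2

/-! ### The largest variable -/

/-- Replacing each variable by the largest one can only increase a monomial. -/
theorem toSyn_le_single_degree {ι : Type*} (m : MonomialOrder ι) {v : ι}
    (hm : ∀ i, i ≠ v → Finsupp.single i 1 ≺[m] Finsupp.single v 1) (s : ι →₀ ℕ) :
    s ≼[m] Finsupp.single v s.degree := by
  induction s using Finsupp.induction_linear with
  | zero => simp
  | add s t hs ht => simpa using add_le_add hs ht
  | single i k =>
    have h1 : m.toSyn (Finsupp.single i 1) ≤ m.toSyn (Finsupp.single v 1) := by
      by_cases h : i = v
      · rw [h]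
      · exact (hm i h).le
    have h2 := nsmul_le_nsmul_right h1 k
    simpa [← map_nsmul] using h2

theorem degree_eq_single_of_isHomogeneous {ι K : Type*} [Field K] (m : MonomialOrder ι) {v : ι}
    (hm : ∀ i, i ≠ v → Finsupp.single i 1 ≺[m] Finsupp.single v 1) {p : MvPolynomial ι K} {d : ℕ}
    (hp : p.IsHomogeneous d) (hc : coeff (Finsupp.single v d) p ≠ 0) :
    m.degree p = Finsupp.single v d := by
  apply m.toSyn.injective
  refine le_antisymm (m.degree_le_iff.2 fun t ht => ?_) (m.le_degree (mem_support_iff.2 hc))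
  have h := toSyn_le_single_degree m hm t
  have hd : t.degree = d := by
    by_contra hne
    exact mem_support_iff.1 ht (hp.coeff_eq_zero hne)
  rwa [hd] at h

/-- The ideal of the coordinate point at `v`. -/
noncomputable def coordinateIdeal {ι : Type*} (K : Type*) [Field K] (v : ι) :
    Ideal (MvPolynomial ι K) :=
  Ideal.span ((fun j => (X j : MvPolynomial ι K)) '' {j | j ≠ v})

theorem mem_coordinateIdeal_iff {ι K : Type*} [Field K] {v : ι} {p : MvPolynomial ι K} :
    p ∈ coordinateIdeal K v ↔ ∀ d, coeff (Finsupp.single v d) p = 0 := by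
  classical
  refine mem_ideal_span_X_image.trans ⟨fun h d => ?_, fun h s hs => ?_⟩
  · by_contra hd
    obtain ⟨i, hi, hi'⟩ := h _ (mem_support_iff.2 hd)
    exact hi' (by simp [Ne.symm hi])
  · by_contra! hs'
    have : s = Finsupp.single v (s v) := by
      ext i
      by_cases hi : i = v
      · simp [hi]
      · simp [Ne.symm hi, hs' i hi]
    exact mem_support_iff.1 hs (this ▸ h _)

theorem notMem_coordinateIdeal_iff_of_isHomogeneous {ι K : Type*} [Field K] {v : ι}
    {p : MvPolynomial ι K} {d : ℕ} (hp : p.IsHomogeneous d) :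
    p ∉ coordinateIdeal K v ↔ coeff (Finsupp.single v d) p ≠ 0 := by
  rw [mem_coordinateIdeal_iff, not_forall]
  refine ⟨fun ⟨e, he⟩ => ?_, fun h => ⟨d, h⟩⟩
  obtain rfl : e = d := by
    by_contra hne
    exact he (hp.coeff_eq_zero (by simpa using hne))
  exact he

theorem X_notMem_coordinateIdeal {ι K : Type*} [Field K] (v : ι) :
    (X v : MvPolynomial ι K) ∉ coordinateIdeal K v := by
  classical
  rw [notMem_coordinateIdeal_iff_of_isHomogeneous (isHomogeneous_X K v), X, coeff_monomial]
  simp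

theorem coordinateIdeal_isPrime {ι : Type*} (K : Type*) [Field K] (v : ι) :
    (coordinateIdeal K v).IsPrime := by
  classical
  let ψ : MvPolynomial ι K →ₐ[K] MvPolynomial ι K := aeval fun i => if i = v then X v else 0
  -- This identifies the ideal with the kernel of `ψ`, a map into a domain.
  have h1 : ∀ p, p - ψ p ∈ coordinateIdeal K v := by
    intro p
    rw [← Ideal.Quotient.eq]
    have : Ideal.Quotient.mkₐ K (coordinateIdeal K v) =
        (Ideal.Quotient.mkₐ K (coordinateIdeal K v)).comp ψ := by
      ext i
      by_cases hi : i = v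
      · simp [ψ, hi]
      · simp only [ψ, AlgHom.comp_apply, aeval_X, if_neg hi, map_zero]
        exact Ideal.Quotient.eq_zero_iff_mem.2 (Ideal.subset_span ⟨i, hi, rfl⟩)
    exact DFunLike.congr_fun this p
  have h2 : coordinateIdeal K v = RingHom.ker ψ := by
    refine le_antisymm (Ideal.span_le.2 ?_) fun p hp => ?_
    · rintro _ ⟨i, hi, rfl⟩
      simp [ψ, RingHom.mem_ker, show i ≠ v from hi]
    · have := h1 p
      rwa [RingHom.mem_ker.1 hp, sub_zero] at this
  rw [h2]
  exact RingHom.ker_isPrime _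

/-- A power of `x_v` occurring in an element of `I` would lead its homogeneous component, although
its support is empty or the face `{v}`. -/
theorem le_coordinateIdeal {ι K : Type*} [Field K] {m : MonomialOrder ι}
    {I : Ideal (MvPolynomial ι K)} {Δ : AbstractSimplicialComplex ι}
    (hI : I.IsHomogeneous (homogeneousSubmodule ι K))
    (hin : initialIdeal m I = stanleyReisnerIdeal K Δ) {v : ι}
    (hm : ∀ i, i ≠ v → Finsupp.single i 1 ≺[m] Finsupp.single v 1) :
    I ≤ coordinateIdeal K v := by
  intro p hp
  rw [mem_coordinateIdeal_iff]
  by_contra! h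
  obtain ⟨d, hd⟩ := h
  have hc : coeff (Finsupp.single v d) (homogeneousComponent d p) ≠ 0 := by
    rwa [coeff_homogeneousComponent, if_pos (by simp)]
  have hdeg := degree_eq_single_of_isHomogeneous m hm (homogeneousComponent_isHomogeneous d p) hc
  have hne : homogeneousComponent d p ≠ 0 := fun h => hc (by simp [h])
  have hface := isNonface_support_degree hin (homogeneousComponent_mem hI hp d) hne
  rw [hdeg] at hface
  have hd0 : d ≠ 0 := by
    rintro rfl
    simpa using hface.1
  rw [show (Finsupp.single v d).support = {v} by ext; simp [hd0, eq_comm]]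
    at hface
  exact hface.2 (Δ.singleton_mem v)

/-! ### Dehomogenization at a coordinate point -/

/-- This is `p(x / y) * y ^ d = p(x)`, needed for `y` the image of `X v` in the localization. -/
theorem MvPolynomial.IsHomogeneous.map_mul_pow_eq {ι K L : Type*} [CommSemiring K] [CommSemiring L]
    {θ α : MvPolynomial ι K →+* L} {y : L} (hC : ∀ c, θ (C c) = α (C c))
    (hX : ∀ i, θ (X i) * y = α (X i)) {p : MvPolynomial ι K} {d : ℕ} (hp : p.IsHomogeneous d) :
    θ p * y ^ d = α p := by
  have hmon (s : ι →₀ ℕ) (c : K) : θ (monomial s c) * y ^ s.degree = α (monomial s c) := by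
    rw [monomial_eq, map_mul, map_mul, hC, mul_assoc, Finsupp.prod, map_prod, map_prod,
      Finsupp.degree_apply, ← Finset.prod_pow_eq_pow_sum, ← Finset.prod_mul_distrib]
    congr 1
    refine Finset.prod_congr rfl fun i _ => ?_
    rw [map_pow, map_pow, ← mul_pow, hX]
  rw [p.as_sum, map_sum, map_sum, Finset.sum_mul]
  refine Finset.sum_congr rfl fun s hs => ?_
  rw [← hmon]
  congr 2
  by_contra hne
  exact mem_support_iff.1 hs (hp.coeff_eq_zero (Ne.symm hne))

theorem MvPolynomial.homogeneousComponent_add_mul {ι K : Type*} [CommSemiring K]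
    {p : MvPolynomial ι K} {d : ℕ} (hp : p.IsHomogeneous d) (c : MvPolynomial ι K) (e : ℕ) :
    homogeneousComponent (e + d) (c * p) = homogeneousComponent e c * p := by
  have h := DirectSum.coe_decompose_mul_add_of_right_mem (homogeneousSubmodule ι K) (i := e)
    (a := c) ((mem_homogeneousSubmodule d p).2 hp)
  rwa [show (DirectSum.decompose (homogeneousSubmodule ι K) (c * p) (e + d) : MvPolynomial ι K) =
      homogeneousComponent (e + d) (c * p) from decomposition.decompose'_apply _ _,
    show (DirectSum.decompose (homogeneousSubmodule ι K) c e : MvPolynomial ι K) =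
      homogeneousComponent e c from decomposition.decompose'_apply _ _] at h

/-- Setting the variable `v` to one presents the homogeneous localization of `S/I` at the
coordinate point `v`. -/
theorem exists_dehomogenization {ι K : Type*} [Field K] (I : Ideal (MvPolynomial ι K))
    (hI : I.IsHomogeneous (homogeneousSubmodule ι K)) (v : ι)
    (P : Ideal (MvPolynomial ι K ⧸ I)) [P.IsPrime]
    (hP : P.comap (Ideal.Quotient.mk I) = coordinateIdeal K v) :
    letI := quotientGradedAlgebra I hI
    ∃ φ : MvPolynomial ι K →+* HomogeneousLocalization.AtPrime (quotientGrading I) P,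
      φ (X v) = 1 ∧ (∀ p ∈ I, φ p = 0) ∧
      (∀ p d, p.IsHomogeneous d → φ p = 0 →
        ∃ c e, c.IsHomogeneous e ∧ c ∉ coordinateIdeal K v ∧ c * p ∈ I) ∧
      (∀ r, ∃ p q d, p.IsHomogeneous d ∧ q.IsHomogeneous d ∧ q ∉ coordinateIdeal K v ∧
        φ q * r = φ p) ∧
      (∀ p d, p.IsHomogeneous d → (IsUnit (φ p) ↔ p ∉ coordinateIdeal K v)) := by
  let := quotientGradedAlgebra I hI
  have hmem (p) : Ideal.Quotient.mk I p ∈ P ↔ p ∈ coordinateIdeal K v := by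
    rw [← hP, Ideal.mem_comap]
  have hXv : Ideal.Quotient.mk I (X v) ∉ P := fun h => X_notMem_coordinateIdeal v ((hmem _).1 h)
  let 𝒜 := quotientGrading I
  let R := HomogeneousLocalization.AtPrime 𝒜 P
  let frac (p q : MvPolynomial ι K) (d : ℕ) (hp : p.IsHomogeneous d) (hq : q.IsHomogeneous d)
      (hqP : Ideal.Quotient.mk I q ∉ P) : R :=
    HomogeneousLocalization.mk ⟨d, ⟨Ideal.Quotient.mk I p, mk_mem_quotientGrading I hp⟩,
      ⟨Ideal.Quotient.mk I q, mk_mem_quotientGrading I hq⟩, hqP⟩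
  let φ : MvPolynomial ι K →+* R :=
    eval₂Hom ((HomogeneousLocalization.fromZeroRingHom 𝒜 P.primeCompl).comp (algebraMap K (𝒜 0)))
      fun i => frac (X i) (X v) 1 (isHomogeneous_X K i) (isHomogeneous_X K v) hXv
  let L := Localization P.primeCompl
  let α : MvPolynomial ι K →+* L := (algebraMap (MvPolynomial ι K ⧸ I) L).comp (Ideal.Quotient.mk I)
  have hinj : Function.Injective (algebraMap R L) := HomogeneousLocalization.val_injective _
  have hfrac (p q d hp hq hqP) : algebraMap R L (frac p q d hp hq hqP) * α q = α p := by
    change Localization.mk _ _ * _ = _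
    rw [Localization.mk_eq_mk']
    exact IsLocalization.mk'_spec L _ (⟨_, hqP⟩ : P.primeCompl)
  have hsurj (r : R) : ∃ p q d hp hq hb, r = frac p q d hp hq hb := by
    obtain ⟨⟨d, ⟨_, p, hp, rfl⟩, ⟨_, q, hq, rfl⟩, hb⟩, rfl⟩ :=
      HomogeneousLocalization.mk_surjective r
    exact ⟨p, q, d, hp, hq, hb, rfl⟩
  have hφX (i) : φ (X i) = frac (X i) (X v) 1 (isHomogeneous_X K i) (isHomogeneous_X K v) hXv :=
    eval₂Hom_X' _ _ i
  have hunit (q) (hq : Ideal.Quotient.mk I q ∉ P) : IsUnit (α q) :=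
    IsLocalization.map_units L (⟨_, hq⟩ : P.primeCompl)
  have key {p d} (hp : p.IsHomogeneous d) : algebraMap R L (φ p) * α (X v) ^ d = α p := by
    refine hp.map_mul_pow_eq (L := L) (θ := (algebraMap R L).comp φ) (fun c => ?_) fun i => ?_
    · rw [RingHom.comp_apply, eval₂Hom_C]
      change Localization.mk _ _ = _
      rw [Localization.mk_eq_mk']
      exact IsLocalization.mk'_one (M := P.primeCompl) L _
    · rw [RingHom.comp_apply, hφX]
      exact hfrac _ _ 1 (isHomogeneous_X K i) (isHomogeneous_X K v) hXv
  have hα0 (p) (hp : p ∈ I) : α p = 0 := by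
    simp [α, Ideal.Quotient.eq_zero_iff_mem.2 hp]
  -- `R` embeds in `L`, where `x_v` is a unit, so `key` moves vanishing to the full localization.
  have hφ0 {p d} (hp : p.IsHomogeneous d) : φ p = 0 ↔ α p = 0 := by
    rw [← key hp, ((hunit _ hXv).pow d).mul_left_eq_zero, ← map_zero (algebraMap R L), hinj.eq_iff]
  refine ⟨φ, ?_, ?_, ?_, ?_, ?_⟩
  · apply hinj
    have h := key (isHomogeneous_X K v)
    rw [pow_one] at h
    rw [map_one]
    exact (hunit _ hXv).mul_right_cancel (by rw [h, one_mul])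
  · intro p hp
    rw [← sum_homogeneousComponent p, map_sum]
    exact Finset.sum_eq_zero fun d _ => (hφ0 (homogeneousComponent_isHomogeneous d p)).2
      (hα0 _ (homogeneousComponent_mem hI hp d))
  · intro p d hp h0
    rw [hφ0 hp] at h0
    obtain ⟨⟨c, hc⟩, hcp⟩ := (IsLocalization.map_eq_zero_iff P.primeCompl L _).1 h0
    obtain ⟨c, rfl⟩ := Ideal.Quotient.mk_surjective c
    have hc' : c ∉ coordinateIdeal K v := fun h => hc ((hmem c).2 h)
    -- The annihilator `c` is replaced by its component of a degree `e` in which `x_v^e` occurs. As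
    -- `p` is a form, that component times `p` is a component of `c * p`, hence in `I`.
    rw [mem_coordinateIdeal_iff] at hc'
    push Not at hc'
    obtain ⟨e, he⟩ := hc'
    have hch := homogeneousComponent_isHomogeneous e c
    refine ⟨homogeneousComponent e c, e, hch, ?_, ?_⟩
    · rw [notMem_coordinateIdeal_iff_of_isHomogeneous hch, coeff_homogeneousComponent,
        if_pos (by simp)]
      exact he
    · have hcp' : c * p ∈ I := by
        rw [← Ideal.Quotient.eq_zero_iff_mem, map_mul]; exact hcp
      have h := homogeneousComponent_mem hI hcp' (e + d)
      rwa [homogeneousComponent_add_mul hp] at h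
  · intro r
    obtain ⟨p, q, d, hp, hq, hb, rfl⟩ := hsurj r
    refine ⟨p, q, d, hp, hq, fun h => hb ((hmem q).2 h), ?_⟩
    apply hinj
    apply ((hunit _ hXv).pow d).mul_right_cancel
    have aux {M : Type _} [CommMonoid M] {a b c y z : M} (h1 : a * y = b) (h2 : c * b = z) :
        a * c * y = z := by rw [mul_right_comm, h1, mul_comm, h2]
    rw [key hp, map_mul]
    exact aux (M := L) (key hq) (hfrac p q d hp hq hb)
  · intro p d hp
    rw [← hmem, ← HomogeneousLocalization.isUnit_iff_isUnit_val]
    change IsUnit (algebraMap R L (φ p)) ↔ _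
    refine Iff.trans ?_ (IsLocalization.AtPrime.isUnit_to_map_iff L P (Ideal.Quotient.mk I p))
    change _ ↔ IsUnit (α p)
    obtain ⟨u, hu⟩ := (hunit _ hXv).pow d
    rw [← key hp, ← hu]
    exact (Units.isUnit_mul_units _ u).symm

/-- Each homogeneous component is padded to degree `d` by a power of `X v`, which `φ` does not see.
-/
theorem MvPolynomial.exists_isHomogeneous_map_eq {ι K R : Type*} [Field K] [CommRing R]
    {φ : MvPolynomial ι K →+* R} {v : ι} (hv : φ (X v) = 1) {p : MvPolynomial ι K} {d : ℕ}
    (hp : p.totalDegree ≤ d) : ∃ q : MvPolynomial ι K, q.IsHomogeneous d ∧ φ q = φ p := by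
  refine ⟨∑ e ∈ Finset.range (d + 1), homogeneousComponent e p * X v ^ (d - e), ?_, ?_⟩
  · refine IsHomogeneous.sum _ _ _ fun e he => ?_
    have h := (homogeneousComponent_isHomogeneous e p).mul ((isHomogeneous_X K v).pow (d - e))
    rwa [one_mul, Nat.add_sub_cancel' (by simpa [Nat.lt_succ_iff] using he)] at h
  · have hsum : p = ∑ e ∈ Finset.range (d + 1), homogeneousComponent e p := by
      conv_lhs => rw [← sum_homogeneousComponent p]
      refine Finset.sum_subset (Finset.range_subset_range.2 (by omega)) fun e _ he => ?_
      exact homogeneousComponent_eq_zero _ _ (by simpa using he)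
    conv_rhs => rw [hsum]
    simp [hv]

/-- The dehomogenization of `S/I` has Krull dimension at most one. -/
theorem ringKrullDim_le_one_of_dehomogenization {ι K R : Type*} [Fintype ι] [Field K] [CommRing R]
    [Nontrivial R] {m : MonomialOrder ι} {I : Ideal (MvPolynomial ι K)}
    {Δ : AbstractSimplicialComplex ι} (hΔ : Δ.HasDim 1)
    (hI : I.IsHomogeneous (homogeneousSubmodule ι K))
    (hin : initialIdeal m I = stanleyReisnerIdeal K Δ) {v : ι} (φ : MvPolynomial ι K →+* R)
    (hv : φ (X v) = 1) (hφI : ∀ p ∈ I, φ p = 0)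
    (hφ : ∀ r, ∃ p q, IsUnit (φ q) ∧ φ q * r = φ p) : ringKrullDim R ≤ 1 := by
  classical
  have : Inhabited ι := ⟨v⟩
  have : Nontrivial (MvPolynomial ι K ⧸ RingHom.ker φ) :=
    Ideal.Quotient.nontrivial_iff.2 (RingHom.ker_ne_top φ)
  -- The growth bound needs a finitely generated algebra, so it is proved for `S / ker φ` and passed
  -- on to `R`.
  refine (ringKrullDim_le_of_forall_exists_isUnit_mul (RingHom.kerLift φ) fun r => ?_).trans ?_
  · obtain ⟨p, q, hq, h⟩ := hφ r
    exact ⟨Ideal.Quotient.mk _ p, φ q, hq, h⟩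
  · refine ringKrullDim_le_one_of_card_span_le (K := K) (Ideal.Quotient.mkₐ K (RingHom.ker φ))
      (Ideal.Quotient.mkₐ_surjective K _) (Fintype.card ι * Fintype.card ι) fun d => ?_
    refine ⟨(Finset.univ ×ˢ Finset.univ ×ˢ Finset.range (d + 1)).image
      fun x : ι × ι × ℕ => Ideal.Quotient.mkₐ K (RingHom.ker φ)
        (monomial (Finsupp.single x.1 x.2.2 + Finsupp.single x.2.1 (d - x.2.2)) 1), ?_, ?_⟩
    · refine Finset.card_image_le.trans ?_
      simp [Finset.card_product, mul_assoc]
    · intro p hp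
      obtain ⟨p', hp', hpp'⟩ := exists_isHomogeneous_map_eq hv hp
      obtain ⟨q, hq, hspan⟩ := exists_sub_mem_span_standard hI hin d p' hp'
      have heq : Ideal.Quotient.mkₐ K (RingHom.ker φ) p =
          Ideal.Quotient.mkₐ K (RingHom.ker φ) (p' - q) := by
        refine Ideal.Quotient.eq.2 ?_
        rw [RingHom.mem_ker, map_sub, map_sub, hpp', hφI q hq, sub_zero, sub_self]
      rw [heq]
      have h := Submodule.mem_map_of_mem (f := (Ideal.Quotient.mkₐ K (RingHom.ker φ)).toLinearMap)
        hspan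
      rw [Submodule.map_span] at h
      refine Submodule.span_mono ?_ h
      rintro _ ⟨_, ⟨s, ⟨hsd, hs⟩, rfl⟩, rfl⟩
      obtain ⟨i, j, k, hk, hsk⟩ := hΔ.exists_eq_single_add_single hs
      rw [hsd] at hk hsk
      simp only [Finset.coe_image, Set.mem_image]
      exact ⟨(i, j, k), by simp; omega, by rw [← hsk]; rfl⟩

/-! ### Two edges through a vertex and the singularity -/

theorem degree_mul_X_pow_of_notMem_coordinateIdeal {ι K : Type*} [Field K] {m : MonomialOrder ι}
    {v : ι} (hm : ∀ i, i ≠ v → Finsupp.single i 1 ≺[m] Finsupp.single v 1) {c : MvPolynomial ι K}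
    {e : ℕ} (hc : c.IsHomogeneous e) (hcv : c ∉ coordinateIdeal K v) (a : ι) (k : ℕ) :
    c * X a ^ k ≠ 0 ∧ m.degree (c * X a ^ k) = Finsupp.single v e + Finsupp.single a k := by
  have hc0 : c ≠ 0 := fun h => hcv (h ▸ zero_mem _)
  have hX0 : (X a ^ k : MvPolynomial ι K) ≠ 0 := pow_ne_zero _ (X_ne_zero a)
  refine ⟨mul_ne_zero hc0 hX0, ?_⟩
  rw [m.degree_mul hc0 hX0, degree_eq_single_of_isHomogeneous m hm hc
    ((notMem_coordinateIdeal_iff_of_isHomogeneous hc).1 hcv), m.degree_pow, m.degree_X]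
  simp

theorem AbstractSimplicialComplex.not_isNonface_support_single_add_single {ι : Type*}
    [DecidableEq ι] {Δ : AbstractSimplicialComplex ι} {v a : ι} (h : {v, a} ∈ Δ.faces) (e k : ℕ) :
    ¬ Δ.IsNonface (Finsupp.single v e + Finsupp.single a k).support := by
  rintro ⟨hne, hnot⟩
  have hsub : (Finsupp.single v e + Finsupp.single a k).support ⊆ {v, a} := ?_
  · exact hnot ((Δ.isRelLowerSet_faces h).2 hsub hne)
  refine Finsupp.support_add.trans (Finset.union_subset ?_ ?_)
  · exact Finsupp.support_single_subset.trans (by simp)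
  · exact Finsupp.support_single_subset.trans (by simp)

/-- Some facet contains `v`, hence at least two do. Neither is `{v}`, which would lie inside the
other, so both are edges. -/
theorem AbstractSimplicialComplex.exists_ne_of_not_isLeaf {ι : Type*} [Finite ι] [DecidableEq ι]
    {Δ : AbstractSimplicialComplex ι} (hΔ : Δ.HasDim 1) {v : ι} (h : ¬ Δ.IsLeaf v) :
    ∃ a b : ι, a ≠ v ∧ b ≠ v ∧ a ≠ b ∧ {v, a} ∈ Δ.faces ∧ {v, b} ∈ Δ.faces := by
  have key {F G : Finset ι} (hF : Δ.IsMaximalFace F) (hG : Δ.IsMaximalFace G) (hvF : v ∈ F)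
      (hvG : v ∈ G) (hne : F ≠ G) : ∃ a, a ≠ v ∧ F = {v, a} := by
    have hF1 : F ≠ {v} := by
      rintro rfl
      exact hne (hF.eq_of_le hG.prop (Finset.singleton_subset_iff.2 hvG))
    have h1 : F.card ≠ 1 := by
      intro h
      obtain ⟨w, rfl⟩ := Finset.card_eq_one.1 h
      exact hF1 (by rw [Finset.mem_singleton.1 hvF])
    have h2 : F.card = 2 := by
      have := hΔ.2 F hF.prop
      have := Finset.card_pos.2 ⟨v, hvF⟩
      omega
    obtain ⟨a, ha⟩ := Finset.card_eq_one.1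
      (show (F.erase v).card = 1 by rw [Finset.card_erase_of_mem hvF, h2])
    refine ⟨a, Finset.ne_of_mem_erase (s := F) (by rw [ha]; simp), ?_⟩
    rw [← Finset.insert_erase hvF, ha]
  obtain ⟨F, hvF, hF⟩ := (Set.toFinite Δ.faces).exists_le_maximal (Δ.singleton_mem v)
  have hvF' : v ∈ F := hvF (Finset.mem_singleton_self v)
  have h' : ∃ G, Δ.IsMaximalFace G ∧ v ∈ G ∧ G ≠ F := by
    by_contra! hG
    exact h ⟨F, ⟨hF, hvF'⟩, fun G hG' => hG G hG'.1 hG'.2⟩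
  obtain ⟨G, hG, hvG, hne⟩ := h'
  obtain ⟨a, ha, rfl⟩ := key hF hG hvF' hvG hne.symm
  obtain ⟨b, hb, rfl⟩ := key hG hF hvG hvF' hne
  exact ⟨a, b, ha, hb, fun hab => hne (by rw [hab]), hF.prop, hG.prop⟩

/-- If two edges of `Δ` meet in `v`, no dehomogenization of `S/I` at `v` is a regular local ring. -/
theorem not_isRegularLocalRing_of_dehomogenization {ι K R : Type*} [Fintype ι] [DecidableEq ι]
    [Field K] [CommRing R] {m : MonomialOrder ι} {I : Ideal (MvPolynomial ι K)}
    {Δ : AbstractSimplicialComplex ι} (hΔ : Δ.HasDim 1)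
    (hI : I.IsHomogeneous (homogeneousSubmodule ι K))
    (hin : initialIdeal m I = stanleyReisnerIdeal K Δ) {v a b : ι}
    (hm : ∀ i, i ≠ v → Finsupp.single i 1 ≺[m] Finsupp.single v 1)
    (ha : a ≠ v) (hb : b ≠ v) (hab : a ≠ b) (hva : {v, a} ∈ Δ.faces) (hvb : {v, b} ∈ Δ.faces)
    (φ : MvPolynomial ι K →+* R) (hv : φ (X v) = 1) (hφI : ∀ p ∈ I, φ p = 0)
    (hφ0 : ∀ p d, p.IsHomogeneous d → φ p = 0 →
      ∃ c e, c.IsHomogeneous e ∧ c ∉ coordinateIdeal K v ∧ c * p ∈ I)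
    (hφ : ∀ r, ∃ p q d, p.IsHomogeneous d ∧ q.IsHomogeneous d ∧ q ∉ coordinateIdeal K v ∧
      φ q * r = φ p)
    (hφu : ∀ p d, p.IsHomogeneous d → (IsUnit (φ p) ↔ p ∉ coordinateIdeal K v)) :
    ¬ IsRegularLocalRing R := by
  intro hR
  have hdim : ringKrullDim R ≤ 1 := by
    refine ringKrullDim_le_one_of_dehomogenization hΔ hI hin φ hv hφI fun r => ?_
    obtain ⟨p, q, d, -, hq, hqv, h⟩ := hφ r
    exact ⟨p, q, (hφu q d hq).2 hqv, h⟩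
  -- Otherwise `I` contains some `c * X w` whose leading monomial `x_v^e x_w` is supported on the
  -- face `{v, w}`.
  have hne {w : ι} (hw : {v, w} ∈ Δ.faces) : φ (X w) ≠ 0 := by
    intro h
    obtain ⟨c, e, hc, hcv, hcI⟩ := hφ0 _ _ (isHomogeneous_X K w) h
    obtain ⟨h0, hdeg⟩ := degree_mul_X_pow_of_notMem_coordinateIdeal hm hc hcv w 1
    rw [pow_one] at h0 hdeg
    exact Δ.not_isNonface_support_single_add_single hw e 1
      (hdeg ▸ isNonface_support_degree hin hcI h0)
  have hnu {w : ι} (hw : w ≠ v) : ¬ IsUnit (φ (X w)) := fun h =>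
    (hφu _ _ (isHomogeneous_X K w)).1 h (Ideal.subset_span ⟨w, hw, rfl⟩)
  obtain ⟨k, l, hk, -, u, hu, hkl⟩ := IsRegularLocalRing.exists_isUnit_mul_pow_eq_pow hdim
    (hne hva) (hne hvb) (hnu ha) (hnu hb)
  obtain ⟨p, q, d, hp, hq, hqv, hpq⟩ := hφ u
  have hpv : p ∉ coordinateIdeal K v :=
    (hφu p d hp).1 (hpq ▸ ((hφu q d hq).2 hqv).mul hu)
  have hXv := X_notMem_coordinateIdeal (K := K) v
  have hprime := coordinateIdeal_isPrime K v
  have hhom {f : MvPolynomial ι K} (hf : f.IsHomogeneous d) (w : ι) (i j : ℕ) :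
      (f * X v ^ j * X w ^ i).IsHomogeneous (d + j + i) := by
    simpa using (hf.mul ((isHomogeneous_X K v).pow j)).mul ((isHomogeneous_X K w).pow i)
  -- With `u = φ p / φ q`, the powers of `X v` give both terms the same degree and disappear under
  -- `φ`.
  have h0 : φ (q * X v ^ l * X a ^ k - p * X v ^ k * X b ^ l) = 0 := by
    simp only [map_sub, map_mul, map_pow, hv, one_pow, mul_one]
    rw [hkl, ← hpq, mul_assoc, sub_self]
  obtain ⟨c, e, hc, hcv, hcI⟩ := hφ0 _ (d + l + k)
    ((hhom hq a k l).sub (by rw [add_right_comm]; exact hhom hp b l k)) h0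
  have hdeg {f : MvPolynomial ι K} (hf : f.IsHomogeneous d) (hfv : f ∉ coordinateIdeal K v)
      (w : ι) (i j : ℕ) : m.degree (c * (f * X v ^ j) * X w ^ i) =
        Finsupp.single v (e + (d + j)) + Finsupp.single w i := by
    refine (degree_mul_X_pow_of_notMem_coordinateIdeal hm (hc.mul (hf.mul ?_)) ?_ w i).2
    · simpa using (isHomogeneous_X K v).pow j
    · exact hprime.mul_notMem hcv (hprime.mul_notMem hfv fun h => hXv (hprime.mem_of_pow_mem _ h))
  set g := c * (q * X v ^ l) * X a ^ k with hg
  set g' := c * (p * X v ^ k) * X b ^ l with hg'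
  have hgg : c * (q * X v ^ l * X a ^ k - p * X v ^ k * X b ^ l) = g + -g' := by
    rw [hg, hg']; ring
  rw [hgg] at hcI
  have hgd : m.degree g = _ := hdeg hq hqv a k l
  have hgd' : m.degree (-g') = _ := m.degree_neg.trans (hdeg hp hpv b l k)
  -- The exponents at `a` are `k ≠ 0` and `0`, so the leading terms cannot cancel.
  have hgne : m.degree g ≠ m.degree (-g') := by
    rw [hgd, hgd']
    intro h
    have := DFunLike.congr_fun h a
    simp [ha, hab, hk] at this
  have hsum0 : g + -g' ≠ 0 := by
    intro h
    exact hgne (by rw [eq_neg_of_add_eq_zero_left h, m.degree_neg])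
  have hface := isNonface_support_degree hin hcI hsum0
  have hmax := m.degree_add_of_ne hgne
  rcases max_choice (m.toSyn (m.degree g)) (m.toSyn (m.degree (-g'))) with h | h
  · rw [m.toSyn.injective (hmax.trans h), hgd] at hface
    exact Δ.not_isNonface_support_single_add_single hva _ _ hface
  · rw [m.toSyn.injective (hmax.trans h), hgd'] at hface
    exact Δ.not_isNonface_support_single_add_single hvb _ _ hface

/-- The coordinate point at `v`, as a point of `Proj S/I`. -/
theorem exists_isCoordinatePoint {ι K : Type*} [Field K] {I : Ideal (MvPolynomial ι K)}
    (hI : I.IsHomogeneous (homogeneousSubmodule ι K)) {v : ι} (hle : I ≤ coordinateIdeal K v) :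
    ∃ P : projQuotient I hI, IsCoordinatePoint v P := by
  let := quotientGradedAlgebra I hI
  have hcomap : ((coordinateIdeal K v).map (Ideal.Quotient.mk I)).comap (Ideal.Quotient.mk I) =
      coordinateIdeal K v := by
    rw [Ideal.comap_map_of_surjective _ Ideal.Quotient.mk_surjective, ← RingHom.ker_eq_comap_bot,
      Ideal.mk_ker, sup_eq_left.2 hle]
  have hhom : ((coordinateIdeal K v).map (Ideal.Quotient.mk I)).IsHomogeneous
      (quotientGrading I) := by
    rw [coordinateIdeal, Ideal.map_span]
    refine Ideal.homogeneous_span _ _ ?_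
    rintro _ ⟨_, ⟨j, -, rfl⟩, rfl⟩
    exact ⟨1, mk_mem_quotientGrading I (isHomogeneous_X K j)⟩
  have := coordinateIdeal_isPrime K v
  have hprime : ((coordinateIdeal K v).map (Ideal.Quotient.mk I)).IsPrime :=
    Ideal.map_isPrime_of_surjective Ideal.Quotient.mk_surjective (by rwa [Ideal.mk_ker])
  -- The class of `X v`, of degree one, lies in the irrelevant ideal but not in this prime.
  refine ⟨(⟨⟨_, hhom⟩, hprime, fun h => X_notMem_coordinateIdeal (K := K) v ?_⟩ :
    ProjectiveSpectrum (quotientGrading I)), hcomap⟩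
  rw [← hcomap, Ideal.mem_comap]
  refine h (?_ : _ ∈ HomogeneousIdeal.irrelevant (quotientGrading I))
  rw [HomogeneousIdeal.mem_irrelevant_iff, GradedRing.proj_apply]
  exact DirectSum.decompose_of_mem_ne _ (mk_mem_quotientGrading I (isHomogeneous_X K v)) one_ne_zero

theorem mainTheorem7 {K : Type*} [Field K] {n : ℕ} [NeZero n]
    (Δ : AbstractSimplicialComplex (Fin n)) (hΔ : Δ.HasDim 1)
    (m : MonomialOrder (Fin n))
    (hm : ∀ i : Fin n, i ≠ 0 → Finsupp.single i 1 ≺[m] Finsupp.single (0 : Fin n) 1)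
    (I : Ideal (MvPolynomial (Fin n) K)) (hI : I.IsHomogeneous (homogeneousSubmodule (Fin n) K))
    (hin : initialIdeal m I = stanleyReisnerIdeal K Δ)
    (f : Finset (Fin n) → MvPolynomial (Fin n) K)
    (hf : IsReducedGroebnerBasis m I (f '' {F | Δ.IsMinimalNonface F}))
    (hf_lead : ∀ F, Δ.IsMinimalNonface F → m.leadingTerm (f F) = ∏ i ∈ F, X i)
    (hf_hom : ∀ F, Δ.IsMinimalNonface F → ∃ d, (f F).IsHomogeneous d)
    (h0 : ¬ Δ.IsLeaf 0) :
    ∃ P : projQuotient I hI, IsCoordinatePoint 0 P ∧ IsSingularPoint (projQuotient I hI) P := by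
  have hle := le_coordinateIdeal hI hin hm
  obtain ⟨P, hP⟩ := exists_isCoordinatePoint hI hle
  refine ⟨P, hP, fun hreg => ?_⟩
  obtain ⟨a, b, ha, hb, hab, hva, hvb⟩ := Δ.exists_ne_of_not_isLeaf hΔ h0
  let := quotientGradedAlgebra I hI
  let P' : ProjectiveSpectrum (quotientGrading I) := P
  have hstalk : IsRegularLocalRing ((Proj (quotientGrading I)).presheaf.stalk P') := hreg
  have hreg' : IsRegularLocalRing (HomogeneousLocalization.AtPrime (quotientGrading I)
      P'.asHomogeneousIdeal.toIdeal) :=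
    IsRegularLocalRing.of_ringEquiv
      (Proj.stalkIso (quotientGrading I) P').commRingCatIsoToRingEquiv
  obtain ⟨φ, hv, h1, h2, h3, h4⟩ :=
    exists_dehomogenization I hI 0 P'.asHomogeneousIdeal.toIdeal hP
  exact not_isRegularLocalRing_of_dehomogenization hΔ hI hin hm ha hb hab hva hvb φ hv h1 h2 h3 h4
    hreg'
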